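/- Let $R$ be a (not necessarily commutative) prime ring with an ascending filtration $FR=(F_nR)_{n\in\mathbb Z}$ by additive subgroups ($1\in F_0R$, $F_iR\,F_jR\subseteq F_{i+j}R$) which is Zariskian: exhaustive and separated, $F_{-1}R$ lies in the Jacobson radical of $F_0R$, and the Rees ring $\bigoplus_n F_nR\,X^n\subseteq R[X,X^{-1}]$ is (left) Noetherian. Assume that the associated graded ring $G(R)=\bigoplus_n F_nR/F_{n-1}R$ is a commutative domain. Let $\mathrm{Spec}(R)$ be the set of two-sided prime ideals with the Zariski topology, whose open sets are $X(I)=\{P : I\not\subseteq P\}$ for two-sided ideals $I$. For a two-sided ideal $I$ let $\mathcal L(\kappa_I)$ be the set of left ideals containing some $I^n$, $n\ge 1$. Call a left $R$-module $M$ $\kappa_I$-torsion free if $Lm=0$ with $L\in\mathcal L(\kappa_I)$, $m \in M$ implies $m=0$. Let $Q_I(M)=\varinjlim_{L\in\mathcal L(\kappa_I)}\mathrm{Hom}_R(L,M)$ be the localization of $M$ at $\kappa_I$ when $M$ is $\kappa_I$-torsion free, and $Q_0(M)=0$; $Q_I(R)$ is a ring and $Q_I(M)$ is a $Q_I(R)$-module.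 If $M$ has a filtration $FM$ ($F_iR\,F_jM\subseteq F_{i+j}M$), the quotient filtration on $Q_I(M)$ is $$F_nQ_I(M)=\{q : \text{there is } L\in\mathcal L(\kappa_I) \text{ with } Lq\subseteq M \text{ and } (F_kR\cap L)\,q\subseteq F_{k+n}M \text{ for all } k\in\mathbb Z\}.$$ (0) The filter $\mathcal L(\kappa_I)$ depends only on the open set $X(I)$, so that $X(I)\mapsto Q_I(R)$ and $X(I)\mapsto Q_I(M)$ are well defined presheaves $\widetilde R$ and $\widetilde M$ on $\mathrm{Spec}(R)$. With the quotient filtrations, $\widetilde R$ is a sheaf of filtered rings $\mathcal F\widetilde R$: it is a sheaf, its rings of sections are exhaustively and separatedly filtered, the restriction maps are filtered, and a section which locally lies in degree $n$ of the filtration lies in degree $n$. (1) Let $M$ be a left $R$-module with an exhaustive filtration $FM$, which is $\kappa_I$-torsion free for every two-sided ideal $I\neq 0$, and such that $G(R)$ acts faithfully on every non-zero element of $G(M)=\bigoplus_n F_nM/F_{n-1}M$ (that is, every non-zero element of $G(M)$ has zero annihilator in $G(R)$). Then $\widetilde M$ with the quotient filtrations is a sheaf of filtered $\mathcal F\widetilde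 R$-modules: it is a sheaf of $\widetilde R$-modules, every $Q_I(M)$ is an exhaustively filtered $Q_I(R)$-module, the restriction maps are filtered, and a section which locally lies in degree $n$ of the filtration lies in degree $n$. (2) Let $M=M_0\supseteq M_1\supseteq\cdots$ be a glider representation inside a left $R$-module $\Omega$, i.e. a descending chain of additive subgroups with $F_iR\,M_j\subseteq M_{j-i}$ for $0\le i\le j$. Let $\Omega$ be given any exhaustive filtration $F\Omega$ making it a filtered $FR$-module with $F_{-j}\Omega=M_j$ for all $j\ge0$ (for example, if $FR$ is positive and $\Omega=RM$, the filtration $F_n\Omega=\sum_{i-j=n}F_iR\,M_j$). If $\Omega$ is $\kappa_I$-torsion free for all two-sided $I\ne0$ and every non-zero element of $G(\Omega)$ has zero annihilator in $G(R)$, then $X(I)\mapsto F_0Q_I(\Omega)$, with the chains $F_{-j}Q_I(\Omega)$, $j\ge0$, is a sheaf of glider $\mathcal F^+\widetilde R$-representations. That is, it is the degree zero part of the presheaf $\widetilde\Omega$ of filtered $\mathcal F\widetilde R$-modules; each $F_0Q_I(\Omega)\supseteq F_{-1}Q_I(\Omega)\supseteq\cdots$ is a glider representation of the positive part of the filtration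 of $Q_I(R)$ inside $Q_I(\Omega)$; and it satisfies the separation and gluing axioms, a compatible family of sections $x_i\in F_{-j}$ having a gluing in $F_{-j}$. -/

import Mathlib

open CategoryTheory TopologicalSpace Opposite
open scoped DirectSum

universe u

namespace ZarGlider

noncomputable section

/-! ### Filtered rings and modules, associated graded objects, Rees ring

A filtration of a ring `R` is an ascending chain `F : ℤ → AddSubgroup R` with
`IsRingFiltration F (fun n ↦ F (n - 1))`, i.e. `1 ∈ F 0` and `F i * F j ⊆ F (i + j)`;
a filtration of an `R`-module `M` compatible with `F` is an ascending chain
`FM : ℤ → AddSubgroup M` with `IsModuleFiltration F _ FM _`, i.e. `F i • FM j ⊆ FM (i + j)`. -/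

section Graded

/-- The filtration is exhaustive: its union is everything. -/
def Exhaustive {A : Type*} [AddGroup A] (F : ℤ → AddSubgroup A) : Prop :=
  ∀ a : A, ∃ n : ℤ, a ∈ F n

/-- The filtration is separated: its intersection is zero. -/
def Separated {A : Type*} [AddGroup A] (F : ℤ → AddSubgroup A) : Prop :=
  ∀ a : A, (∀ n : ℤ, a ∈ F n) → a = 0

/-- The homogeneous component `F n / F (n - 1)` of the associated graded group. -/
abbrev GrPiece {A : Type*} [AddCommGroup A] (F : ℤ → AddSubgroup A) (n : ℤ) : Type _ :=
  F n ⧸ (F (n - 1)).addSubgroupOf (F n)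

/-- The class of `a ∈ F n` in `F n / F (n - 1)`. -/
def grMk {A : Type*} [AddCommGroup A] (F : ℤ → AddSubgroup A) (n : ℤ) : F n →+ GrPiece F n :=
  QuotientAddGroup.mk' _

variable {R : Type*} [Ring R] (F : ℤ → AddSubgroup R) [hF : IsRingFiltration F (fun n ↦ F (n - 1))]
variable {M : Type*} [AddCommGroup M] [Module R M] (FM : ℤ → AddSubgroup M)
  [hM : IsModuleFiltration F (fun n ↦ F (n - 1)) FM (fun n ↦ FM (n - 1))]

/-- The associated graded group `⨁ n, F n / F (n - 1)`. -/
abbrev Gr {A : Type*} [AddCommGroup A] (F : ℤ → AddSubgroup A) : Type _ := ⨁ n, GrPiece F n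

lemma grPiece_ind {A : Type*} [AddCommGroup A] {F : ℤ → AddSubgroup A} {n : ℤ}
    {p : GrPiece F n → Prop} (h : ∀ a, p (grMk F n a)) (x : GrPiece F n) : p x :=
  QuotientAddGroup.induction_on x h

lemma grMk_eq_zero {A : Type*} [AddCommGroup A] {F : ℤ → AddSubgroup A} {n : ℤ} {a : F n}
    (h : (a : A) ∈ F (n - 1)) : grMk F n a = 0 :=
  (QuotientAddGroup.eq_zero_iff a).2 h

lemma grMk_sigma {A : Type*} [AddCommGroup A] {F : ℤ → AddSubgroup A} {m n : ℤ} (h : m = n)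
    {a : F m} {b : F n} (hab : (a : A) = b) :
    (⟨m, grMk F m a⟩ : GradedMonoid (GrPiece F)) = ⟨n, grMk F n b⟩ := by
  subst h
  rw [Subtype.ext hab]

/-- The multiplication `F i × FM j → FM (i + j)`. -/
def filSMul (i j : ℤ) : F i →+ FM j →+ FM (i + j) :=
  AddMonoidHom.mk' (fun a ↦ AddMonoidHom.mk' (fun m ↦ ⟨(a : R) • (m : M),
      hM.toGradedSMul.smul_mem a.2 m.2⟩) (fun _ _ ↦ Subtype.ext (smul_add _ _ _)))
    (fun _ _ ↦ AddMonoidHom.ext fun _ ↦ Subtype.ext (add_smul _ _ _))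

/-- The induced multiplication
`F i / F (i - 1) × FM j / FM (j - 1) → FM (i + j) / FM (i + j - 1)`. -/
def grSMul (i j : ℤ) : GrPiece F i →+ GrPiece FM j →+ GrPiece FM (i + j) :=
  QuotientAddGroup.lift _
    (AddMonoidHom.mk' (fun a ↦ QuotientAddGroup.lift _ ((grMk FM (i + j)).comp (filSMul F FM i j a))
      (fun m hm ↦ grMk_eq_zero (by
        have h := hM.toGradedSMul.smul_mem a.2 (show (m : M) ∈ FM (j - 1) from hm)
        rw [vadd_eq_add, ← add_sub_assoc] at h
        exact h)))
      (fun x y ↦ AddMonoidHom.ext fun m ↦ by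
        induction m using grPiece_ind with
        | h m => exact ((congrArg (fun f ↦ grMk FM (i + j) (f m)) (map_add (filSMul F FM i j) x y)).trans
            (map_add _ _ _))))
    (fun a ha ↦ AddMonoidHom.ext fun m ↦ by
      induction m using grPiece_ind with
      | h m =>
        refine grMk_eq_zero ?_
        have h := hM.toGradedSMul.smul_mem (show (a : R) ∈ F (i - 1) from ha) m.2
        rw [vadd_eq_add, sub_add_eq_add_sub] at h
        exact h)

lemma grSMul_mk (i j : ℤ) (a : F i) (m : FM j) :
    grSMul F FM i j (grMk F i a) (grMk FM j m) = grMk FM (i + j) (filSMul F FM i j a m) := rfl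

lemma grSMul_add_left (i j : ℤ) (a b : GrPiece F i) (m : GrPiece FM j) :
    grSMul F FM i j (a + b) m = grSMul F FM i j a m + grSMul F FM i j b m := by
  rw [map_add, AddMonoidHom.add_apply]

lemma grSMul_zero_left (i j : ℤ) (m : GrPiece FM j) : grSMul F FM i j 0 m = 0 := by
  rw [map_zero, AddMonoidHom.zero_apply]

instance selfFiltration : IsModuleFiltration F (fun n ↦ F (n - 1)) F (fun n ↦ F (n - 1)) where
  toIsFiltration := hF.toIsFiltration
  smul_mem := by
    intro i j a b ha hb
    exact SetLike.mul_mem_graded ha hb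

instance grMul : GradedMonoid.GMul (GrPiece F) where
  mul {i j} a b := grSMul F F i j a b

instance grOne : GradedMonoid.GOne (GrPiece F) where
  one := grMk F 0 ⟨1, SetLike.one_mem_graded F⟩

/-- The ring structure of the associated graded ring `G(R)`: the product of the classes of
`a ∈ F i` and `b ∈ F j` is the class of `a * b` in `F (i + j) / F (i + j - 1)`. -/
instance grRing : DirectSum.GRing (GrPiece F) where
  mul_zero _ := map_zero _
  zero_mul b := grSMul_zero_left F F _ _ b
  mul_add _ _ _ := map_add _ _ _
  add_mul a b c := grSMul_add_left F F _ _ a b c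
  one_mul := by
    rintro ⟨i, a⟩
    induction a using grPiece_ind with
    | h a => exact grMk_sigma (zero_add i) (one_mul (a : R))
  mul_one := by
    rintro ⟨i, a⟩
    induction a using grPiece_ind with
    | h a => exact grMk_sigma (add_zero i) (mul_one (a : R))
  mul_assoc := by
    rintro ⟨i, a⟩ ⟨j, b⟩ ⟨k, c⟩
    induction a using grPiece_ind with
    | h a =>
      induction b using grPiece_ind with
      | h b =>
        induction c using grPiece_ind with
        | h c => exact grMk_sigma (add_assoc i j k) (mul_assoc (a : R) b c)
  natCast n := n • grMk F 0 ⟨1, SetLike.one_mem_graded F⟩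
  natCast_zero := zero_nsmul _
  natCast_succ n := succ_nsmul _ _
  intCast n := n • grMk F 0 ⟨1, SetLike.one_mem_graded F⟩
  intCast_ofNat n := natCast_zsmul _ _
  intCast_negSucc_ofNat n := negSucc_zsmul _ _

/-- The `G(R)`-module structure of the associated graded module `G(M)`. -/
instance grModule : DirectSum.Gmodule (GrPiece F) (GrPiece FM) where
  smul {i j} a m := grSMul F FM i j a m
  one_smul := by
    rintro ⟨i, m⟩
    induction m using grPiece_ind with
    | h m =>
      exact grMk_sigma (F := FM) (a := filSMul F FM 0 i ⟨1, SetLike.one_mem_graded F⟩ m) (b := m)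
        (zero_add i) (one_smul R (m : M))
  mul_smul := by
    rintro ⟨i, a⟩ ⟨j, b⟩ ⟨k, m⟩
    induction a using grPiece_ind with
    | h a =>
      induction b using grPiece_ind with
      | h b =>
        induction m using grPiece_ind with
        | h m =>
          exact grMk_sigma (F := FM) (a := filSMul F FM (i + j) k (filSMul F F i j a b) m)
            (b := filSMul F FM i (j + k) a (filSMul F FM j k b m))
            (add_assoc i j k) (mul_smul (a : R) (b : R) (m : M))
  smul_add _ _ _ := map_add _ _ _
  smul_zero _ := map_zero _
  add_smul a b m := grSMul_add_left F FM _ _ a b m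
  zero_smul m := grSMul_zero_left F FM _ _ m

/-- Every non-zero element of `G(M)` is acted on faithfully by `G(R)`: its annihilator is zero. -/
def GrFaithful : Prop :=
  ∀ m : Gr FM, m ≠ 0 → ∀ r : Gr F, r • m = 0 → r = 0

/-- The Rees ring `∑ n, F n Xⁿ ⊆ R[X, X⁻¹]`. -/
def reesRing : Subring (LaurentPolynomial R) where
  carrier := {p | ∀ n : ℤ, p.coeff n ∈ F n}
  mul_mem' {p q} hp hq n := by
    classical
    rw [AddMonoidAlgebra.coeff_mul]
    refine AddSubgroup.sum_mem _ fun i _ ↦ AddSubgroup.sum_mem _ fun j _ ↦ ?_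
    dsimp only
    split_ifs with h
    · exact h ▸ SetLike.mul_mem_graded (hp i) (hq j)
    · exact zero_mem _
  one_mem' n := by
    classical
    rw [AddMonoidAlgebra.one_def, AddMonoidAlgebra.coeff_single, Finsupp.single_apply]
    split_ifs with h
    · exact h ▸ SetLike.one_mem_graded F
    · exact zero_mem _
  add_mem' hp hq n := add_mem (hp n) (hq n)
  zero_mem' n := zero_mem _
  neg_mem' hp n := neg_mem (hp n)

/-- The subring `F 0` of `R`. -/
def zeroSubring : Subring R where
  __ := F 0
  mul_mem' ha hb := by simpa using SetLike.mul_mem_graded (A := F) ha hb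
  one_mem' := SetLike.one_mem_graded F

/-- The filtration is (left) Zariskian: it is exhaustive and separated, `F (-1)` is contained in
the Jacobson radical of `F 0`, and the Rees ring is left Noetherian. -/
structure IsZariskian : Prop where
  exhaustive : Exhaustive F
  separated : Separated F
  le_jacobson : ∀ x : zeroSubring F, (x : R) ∈ F (-1) → x ∈ Ring.jacobson (zeroSubring F)
  noetherian : IsNoetherianRing (reesRing F)

/-- A chain `L 0 ⊇ L 1 ⊇ ...` of additive subgroups of an `R`-module is a glider representation
of the positive part of `F` if `F i • L j ⊆ L (j - i)` for all `0 ≤ i ≤ j`. -/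
structure IsGlider {R : Type*} [Ring R] (F : ℤ → AddSubgroup R) {M : Type*} [AddCommGroup M]
    [Module R M] (L : ℕ → AddSubgroup M) : Prop where
  anti : Antitone L
  smul_mem : ∀ (i j : ℕ), i ≤ j → ∀ a ∈ F i, ∀ m ∈ L j, a • m ∈ L (j - i)

end Graded

/-! ### Localization at the kernel functor of a two-sided ideal -/

section Localization

variable {R : Type u} [Ring R]

/-- The filter of the kernel functor `κ_I` of a two-sided ideal `I`:
all left ideals containing some positive power of `I`. -/
def kappaFilter (I : Ideal R) : Set (Ideal R) :=
  {L | ∃ n : ℕ, 0 < n ∧ I ^ n ≤ L}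

/-- `M` is `κ_I`-torsion free: no non-zero element is annihilated by a member of the filter. -/
def KappaTorsionFree (I : Ideal R) (M : Type*) [AddCommGroup M] [Module R M] : Prop :=
  ∀ m : M, (∃ L ∈ kappaFilter I, ∀ a ∈ L, a • m = 0) → m = 0

lemma kappaFilter_top (I : Ideal R) : ⊤ ∈ kappaFilter I := ⟨1, one_pos, le_top⟩

lemma kappaFilter_inf {I : Ideal R} {L L' : Ideal R} (hL : L ∈ kappaFilter I)
    (hL' : L' ∈ kappaFilter I) : L ⊓ L' ∈ kappaFilter I := by
  obtain ⟨n, hn, h⟩ := hL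
  obtain ⟨m, hm, h'⟩ := hL'
  exact ⟨max n m, lt_max_of_lt_left hn, le_inf ((Ideal.pow_le_pow_right (le_max_left _ _)).trans h)
    ((Ideal.pow_le_pow_right (le_max_right _ _)).trans h')⟩

lemma kappaFilter_mono {I J : Ideal R} (h : J ≤ I) : kappaFilter I ⊆ kappaFilter J :=
  fun _ ⟨n, hn, hL⟩ ↦ ⟨n, hn, (Ideal.pow_right_mono h n).trans hL⟩

variable {I : Ideal R} {M : Type u} [AddCommGroup M] [Module R M]

/-- Composition of partial maps, defined on `{x ∈ dom f | f x ∈ dom g}`. -/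
def pcomp (g : R →ₗ.[R] M) (f : R →ₗ.[R] R) : R →ₗ.[R] M where
  domain := (g.domain.comap f.toFun).map f.domain.subtype
  toFun :=
    { toFun := fun x ↦ g ⟨f ⟨x, by
          obtain ⟨y, -, hy⟩ := x.2
          exact hy ▸ y.2⟩, by
          obtain ⟨_, y, hy, rfl⟩ := x
          exact hy⟩
      map_add' := fun x y ↦ by
        rw [← LinearPMap.map_add]
        congr 1
        exact Subtype.ext (LinearPMap.map_add f ⟨x, _⟩ ⟨y, _⟩)
      map_smul' := fun r x ↦ by
        rw [RingHom.id_apply, ← LinearPMap.map_smul]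
        congr 1
        exact Subtype.ext (LinearPMap.map_smul f r ⟨x, _⟩) }

lemma mem_pcomp {g : R →ₗ.[R] M} {f : R →ₗ.[R] R} {x : R} :
    x ∈ (pcomp g f).domain ↔ ∃ h : x ∈ f.domain, f ⟨x, h⟩ ∈ g.domain := by
  constructor
  · rintro ⟨y, hy, rfl⟩
    exact ⟨y.2, hy⟩
  · rintro ⟨h, h'⟩
    exact ⟨⟨x, h⟩, h', rfl⟩

lemma pcomp_mem [I.IsTwoSided] {g : R →ₗ.[R] M} {f : R →ₗ.[R] R}
    (hg : g.domain ∈ kappaFilter I) (hf : f.domain ∈ kappaFilter I) :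
    (pcomp g f).domain ∈ kappaFilter I := by
  obtain ⟨m, hm, hg⟩ := hg
  obtain ⟨n, hn, hf⟩ := hf
  refine ⟨m + n, by omega, ?_⟩
  rw [Ideal.IsTwoSided.pow_add, Ideal.mul_le]
  intro a ha b hb
  refine mem_pcomp.2 ⟨Submodule.smul_mem _ a (hf hb), ?_⟩
  have h : f ⟨a * b, Submodule.smul_mem _ a (hf hb)⟩ = a * f ⟨b, hf hb⟩ :=
    LinearPMap.map_smul f a ⟨b, hf hb⟩
  rw [h]
  exact hg (Ideal.IsTwoSided.mul_mem_of_left _ ha)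

/-- The partial maps `f` and `g` are defined and equal at `x`. -/
def EqAt (f g : R →ₗ.[R] M) (x : R) : Prop :=
  ∃ (hf : x ∈ f.domain) (hg : x ∈ g.domain), f ⟨x, hf⟩ = g ⟨x, hg⟩

/-- `R`-linear maps `L → M` with `L` in the filter of `κ_I`. -/
def DenseMap (I : Ideal R) (M : Type u) [AddCommGroup M] [Module R M] : Type u := {f : R →ₗ.[R] M // f.domain ∈ kappaFilter I}

/-- Two such maps are identified if they agree on a smaller left ideal of the filter. -/
instance denseSetoid (I : Ideal R) (M : Type u) [AddCommGroup M] [Module R M] :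
    Setoid (DenseMap I M) where
  r f g := ∃ L ∈ kappaFilter I, ∀ x ∈ L, EqAt f.1 g.1 x
  iseqv :=
    { refl := fun f ↦ ⟨_, f.2, fun _ hx ↦ ⟨hx, hx, rfl⟩⟩
      symm := fun ⟨L, hL, h⟩ ↦ ⟨L, hL, fun x hx ↦ let ⟨a, b, e⟩ := h x hx; ⟨b, a, e.symm⟩⟩
      trans := fun ⟨L, hL, h⟩ ⟨L', hL', h'⟩ ↦ ⟨L ⊓ L', kappaFilter_inf hL hL', fun x hx ↦
        let ⟨a, _, e⟩ := h x hx.1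
        let ⟨_, c, e'⟩ := h' x hx.2
        ⟨a, c, e.trans e'⟩⟩ }

/-- The localization `Q_I(M) = colim Hom_R(L, M)`, the colimit over the left ideals `L ⊇ I ^ n`,
of a `κ_I`-torsion free module `M` (so that `M / κ_I(M) = M`). For `I = ⊥`, where every module is
`κ_I`-torsion, the zero left ideal occurs among the `L` and the colimit is zero, as it should. -/
def LocMod (I : Ideal R) (M : Type u) [AddCommGroup M] [Module R M] : Type u := Quotient (denseSetoid I M)

/-- The element of `Q_I(M)` represented by `f : L → M`. -/
def LocMod.mk (f : DenseMap I M) : LocMod I M := Quotient.mk _ f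

lemma LocMod.ind {p : LocMod I M → Prop} (h : ∀ f, p (LocMod.mk f)) (q : LocMod I M) : p q := Quotient.ind h q

lemma LocMod.sound {f g : DenseMap I M} (h : ∃ L ∈ kappaFilter I, ∀ x ∈ L, EqAt f.1 g.1 x) :
    LocMod.mk f = LocMod.mk g := Quotient.sound h

instance : Add (LocMod I M) where
  add := Quotient.map₂ (fun f g ↦ ⟨f.1 + g.1, kappaFilter_inf f.2 g.2⟩)
    (fun _ _ ⟨L, hL, h⟩ _ _ ⟨L', hL', h'⟩ ↦ ⟨L ⊓ L', kappaFilter_inf hL hL', fun x hx ↦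
      let ⟨a, b, e⟩ := h x hx.1
      let ⟨a', b', e'⟩ := h' x hx.2
      ⟨⟨a, a'⟩, ⟨b, b'⟩, congrArg₂ (· + ·) e e'⟩⟩)

instance : Zero (LocMod I M) where
  zero := LocMod.mk ⟨0, kappaFilter_top I⟩

instance : Neg (LocMod I M) where
  neg := Quotient.map (fun f ↦ ⟨-f.1, f.2⟩) (fun _ _ ⟨L, hL, h⟩ ↦ ⟨L, hL, fun x hx ↦
      let ⟨a, b, e⟩ := h x hx
      ⟨a, b, congrArg Neg.neg e⟩⟩)

instance : AddCommGroup (LocMod I M) where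
  add_assoc x y z := by
    induction x using LocMod.ind; induction y using LocMod.ind; induction z using LocMod.ind
    exact congrArg LocMod.mk (Subtype.ext (add_assoc _ _ _))
  zero_add x := by
    induction x using LocMod.ind
    exact congrArg LocMod.mk (Subtype.ext (zero_add _))
  add_zero x := by
    induction x using LocMod.ind
    exact congrArg LocMod.mk (Subtype.ext (add_zero _))
  add_comm x y := by
    induction x using LocMod.ind; induction y using LocMod.ind
    exact congrArg LocMod.mk (Subtype.ext (add_comm _ _))
  neg_add_cancel x := by
    induction x using LocMod.ind with
    | h f =>
      exact LocMod.sound ⟨_, f.2, fun x hx ↦ ⟨⟨hx, hx⟩, trivial, neg_add_cancel (f.1 ⟨x, hx⟩)⟩⟩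
  nsmul := nsmulRec
  zsmul := zsmulRec

variable (M) in
/-- The restriction map `Q_I(M) → Q_J(M)` for `κ_I ≤ κ_J`: it sends the class of `f : L → M` to the
class of `f`. -/
def LocMod.res {J : Ideal R} (h : kappaFilter I ⊆ kappaFilter J) : LocMod I M →+ LocMod J M where
  toFun := Quotient.map (fun f ↦ ⟨f.1, h f.2⟩) (fun _ _ ⟨L, hL, e⟩ ↦ ⟨L, h hL, e⟩)
  map_zero' := rfl
  map_add' x y := by
    induction x using LocMod.ind; induction y using LocMod.ind
    rfl

variable (I) in
/-- The quotient filtration on `Q_I(M)`: an element `q` lies in `F n Q_I(M)` if there is a left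
ideal `L` in the filter of `κ_I` with `(F k ∩ L) q ⊆ FM (k + n)` for all `k`. -/
def quotFil (F : ℤ → AddSubgroup R) (FM : ℤ → AddSubgroup M) (n : ℤ) : AddSubgroup (LocMod I M) where
  carrier := {q | ∃ f : DenseMap I M, LocMod.mk f = q ∧
    ∀ (k : ℤ) (x : f.1.domain), (x : R) ∈ F k → f.1 x ∈ FM (k + n)}
  zero_mem' := ⟨⟨0, kappaFilter_top I⟩, rfl, fun k x _ ↦ zero_mem _⟩
  add_mem' := by
    rintro _ _ ⟨f, rfl, hf⟩ ⟨g, rfl, hg⟩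
    exact ⟨_, rfl, fun k x hx ↦ add_mem (hf k ⟨x, x.2.1⟩ hx) (hg k ⟨x, x.2.2⟩ hx)⟩
  neg_mem' := by
    rintro _ ⟨f, rfl, hf⟩
    exact ⟨_, rfl, fun k x hx ↦ neg_mem (hf k x hx)⟩

variable [I.IsTwoSided]

/-- The action of `Q_I(R)` on `Q_I(M)`: if `q` is represented by `f : L → R` (to be thought of as
`x ↦ x * q`) and `m` by `g : L' → M` (to be thought of as `x ↦ x • m`), then `q • m` is represented
by `g ∘ f`, on the left ideal where it is defined. -/
instance : SMul (LocMod I R) (LocMod I M) where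
  smul := Quotient.map₂ (fun f g ↦ ⟨pcomp g.1 f.1, pcomp_mem g.2 f.2⟩)
    (fun f₁ f₂ ⟨L, hL, h⟩ g₁ g₂ ⟨L', hL', h'⟩ ↦ by
      refine ⟨L ⊓ (pcomp (M := R) (LinearPMap.mk L' L'.subtype) f₁.1).domain,
        kappaFilter_inf hL (pcomp_mem hL' f₁.2), fun x hx ↦ ?_⟩
      obtain ⟨a, b, e⟩ := h x hx.1
      obtain ⟨a', c⟩ := mem_pcomp.1 hx.2
      obtain ⟨u, v, e'⟩ := h' _ c
      refine ⟨mem_pcomp.2 ⟨a, u⟩, mem_pcomp.2 ⟨b, e ▸ v⟩, ?_⟩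
      refine e'.trans ?_
      change g₂.1 ⟨f₁.1 ⟨x, _⟩, _⟩ = g₂.1 ⟨f₂.1 ⟨x, _⟩, _⟩
      congr 2)

lemma LocMod.smul_mk (f : DenseMap I R) (g : DenseMap I M) :
    LocMod.mk f • LocMod.mk g = LocMod.mk ⟨pcomp g.1 f.1, pcomp_mem g.2 f.2⟩ := rfl

/-- The unit of `Q_I(R)`: the identity `R → R`. -/
instance : One (LocMod I R) where
  one := LocMod.mk ⟨LinearPMap.mk ⊤ (Submodule.subtype ⊤), kappaFilter_top I⟩

instance : Mul (LocMod I R) where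
  mul p q := p • q

lemma LocMod.smul_add' (p : LocMod I R) (x y : LocMod I M) : p • (x + y) = p • x + p • y := by
  induction p using LocMod.ind with
  | h f =>
    induction x using LocMod.ind with
    | h g =>
      induction y using LocMod.ind with
      | h k =>
        refine LocMod.sound ⟨_, kappaFilter_inf (pcomp_mem g.2 f.2) (pcomp_mem k.2 f.2), fun x hx ↦ ?_⟩
        obtain ⟨a, b⟩ := mem_pcomp.1 hx.1
        obtain ⟨_, b'⟩ := mem_pcomp.1 hx.2
        exact ⟨mem_pcomp.2 ⟨a, ⟨b, b'⟩⟩, hx, rfl⟩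

lemma LocMod.add_smul' (p q : LocMod I R) (x : LocMod I M) : (p + q) • x = p • x + q • x := by
  induction p using LocMod.ind with
  | h f =>
    induction q using LocMod.ind with
    | h g =>
      induction x using LocMod.ind with
      | h k =>
        refine LocMod.sound ⟨_, kappaFilter_inf (pcomp_mem k.2 f.2) (pcomp_mem k.2 g.2), fun x hx ↦ ?_⟩
        obtain ⟨a, b⟩ := mem_pcomp.1 hx.1
        obtain ⟨a', b'⟩ := mem_pcomp.1 hx.2
        exact ⟨mem_pcomp.2 ⟨⟨a, a'⟩, add_mem b b'⟩, hx, LinearPMap.map_add k.1 ⟨_, b⟩ ⟨_, b'⟩⟩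

lemma LocMod.smul_zero' (p : LocMod I R) : p • (0 : LocMod I M) = 0 := by
  induction p using LocMod.ind with
  | h f => exact LocMod.sound ⟨_, f.2, fun x hx ↦ ⟨mem_pcomp.2 ⟨hx, trivial⟩, trivial, rfl⟩⟩

lemma LocMod.zero_smul' (x : LocMod I M) : (0 : LocMod I R) • x = 0 := by
  induction x using LocMod.ind with
  | h f =>
    exact LocMod.sound ⟨_, kappaFilter_top I, fun x hx ↦ ⟨mem_pcomp.2 ⟨trivial, zero_mem _⟩, trivial,
      LinearPMap.map_zero f.1⟩⟩

lemma LocMod.one_smul' (x : LocMod I M) : (1 : LocMod I R) • x = x := by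
  induction x using LocMod.ind with
  | h f => exact LocMod.sound ⟨_, f.2, fun x hx ↦ ⟨mem_pcomp.2 ⟨trivial, hx⟩, hx, rfl⟩⟩

lemma LocMod.mul_smul' (p q : LocMod I R) (x : LocMod I M) : (p * q) • x = p • q • x := by
  induction p using LocMod.ind with
  | h f =>
    induction q using LocMod.ind with
    | h g =>
      induction x using LocMod.ind with
      | h k =>
        refine LocMod.sound ⟨_, pcomp_mem (pcomp_mem k.2 g.2) f.2, fun x hx ↦ ?_⟩
        obtain ⟨a, b⟩ := mem_pcomp.1 hx
        obtain ⟨c, d⟩ := mem_pcomp.1 b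
        exact ⟨mem_pcomp.2 ⟨mem_pcomp.2 ⟨a, c⟩, d⟩, hx, rfl⟩

lemma LocMod.mul_one' (p : LocMod I R) : p * 1 = p := by
  induction p using LocMod.ind with
  | h f => exact LocMod.sound ⟨_, f.2, fun x hx ↦ ⟨mem_pcomp.2 ⟨hx, trivial⟩, hx, rfl⟩⟩

/-- The ring structure of `Q_I(R)`. -/
instance : Ring (LocMod I R) where
  __ := (inferInstance : AddCommGroup (LocMod I R))
  left_distrib := LocMod.smul_add'
  right_distrib := LocMod.add_smul'
  zero_mul := LocMod.zero_smul'
  mul_zero := LocMod.smul_zero'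
  mul_assoc := LocMod.mul_smul'
  one_mul := LocMod.one_smul'
  mul_one := LocMod.mul_one'

/-- The `Q_I(R)`-module structure of `Q_I(M)`. -/
instance : Module (LocMod I R) (LocMod I M) where
  one_smul := LocMod.one_smul'
  mul_smul := LocMod.mul_smul'
  smul_zero := LocMod.smul_zero'
  smul_add := LocMod.smul_add'
  add_smul := LocMod.add_smul'
  zero_smul := LocMod.zero_smul'

lemma LocMod.res_smul {J : Ideal R} [J.IsTwoSided] (h : kappaFilter I ⊆ kappaFilter J) (p : LocMod I R)
    (x : LocMod I M) : LocMod.res M h (p • x) = LocMod.res R h p • LocMod.res M h x := by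
  induction p using LocMod.ind; induction x using LocMod.ind
  rfl

/-- The restriction map `Q_I(R) → Q_J(R)` is a ring homomorphism. -/
def LocMod.resRing {J : Ideal R} [J.IsTwoSided] (h : kappaFilter I ⊆ kappaFilter J) :
    LocMod I R →+* LocMod J R where
  __ := LocMod.res R h
  map_one' := rfl
  map_mul' p q := LocMod.res_smul h p q

end Localization

/-! ### The prime spectrum of a noncommutative ring and the presheaves on it -/

section Spec

/-- `R` is a prime ring: it is non-zero, and `a R b = 0` implies `a = 0` or `b = 0`. -/
def IsPrimeRing (R : Type*) [Ring R] : Prop :=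
  Nontrivial R ∧ ∀ a b : R, (∀ r : R, a * r * b = 0) → a = 0 ∨ b = 0

/-- `Spec R`, the set of two-sided prime ideals of `R`: proper two-sided ideals `P` such that, for
two-sided ideals `I` and `J`, `I J ⊆ P` implies `I ⊆ P` or `J ⊆ P`. -/
@[ext]
structure PrimeSpec (R : Type u) [Ring R] where
  asIdeal : Ideal R
  isTwoSided : asIdeal.IsTwoSided
  ne_top : asIdeal ≠ ⊤
  le_or_le : ∀ I J : Ideal R, I.IsTwoSided → J.IsTwoSided → I * J ≤ asIdeal →
    I ≤ asIdeal ∨ J ≤ asIdeal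

variable {R : Type u} [Ring R]

instance (P : PrimeSpec R) : P.asIdeal.IsTwoSided := P.isTwoSided

/-- The set `X(I)` of all primes not containing `I`. -/
def basicSet (I : Ideal R) : Set (PrimeSpec R) := {P | ¬ I ≤ P.asIdeal}

lemma iSup_isTwoSided {ι : Type*} (I : ι → Ideal R) (h : ∀ i, (I i).IsTwoSided) :
    (⨆ i, I i).IsTwoSided := by
  refine ⟨fun {a} b ha ↦ ?_⟩
  induction ha using Submodule.iSup_induction' with
  | mem i x hx => exact Submodule.mem_iSup_of_mem i ((h i).mul_mem_of_left b hx)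
  | zero => simp
  | add x y _ _ hx hy => rw [add_mul]; exact add_mem hx hy

/-- The Zariski topology: the open sets are the `X(I)`, for two-sided ideals `I`. -/
instance : TopologicalSpace (PrimeSpec R) where
  IsOpen U := ∃ I : Ideal R, I.IsTwoSided ∧ U = basicSet I
  isOpen_univ := ⟨⊤, inferInstance, Set.ext fun P ↦
    ⟨fun _ h ↦ P.ne_top (top_le_iff.1 h), fun _ ↦ trivial⟩⟩
  isOpen_inter := by
    rintro _ _ ⟨I, hI, rfl⟩ ⟨J, hJ, rfl⟩
    refine ⟨I * J, inferInstance, Set.ext fun P ↦ ⟨fun ⟨h, h'⟩ hIJ ↦ ?_, fun h ↦ ⟨?_, ?_⟩⟩⟩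
    · exact (P.le_or_le I J hI hJ hIJ).elim h h'
    · exact fun h' ↦ h (Ideal.mul_le_left.trans h')
    · exact fun h' ↦ h (Ideal.mul_le_right.trans h')
  isOpen_sUnion := by
    intro S hS
    choose! I hI hU using hS
    refine ⟨⨆ U : S, I U, iSup_isTwoSided _ fun U ↦ hI U U.2, Set.ext fun P ↦ ?_⟩
    simp only [basicSet, Set.mem_sUnion, Set.mem_ofPred_eq, iSup_le_iff, not_forall]
    constructor
    · rintro ⟨U, h, hP⟩
      rw [hU U h] at hP
      exact ⟨⟨U, h⟩, hP⟩
    · rintro ⟨U, hP⟩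
      refine ⟨U, U.2, ?_⟩
      rw [hU U U.2]
      exact hP

/-- The open set `X(I)`. -/
def basicOpen (I : Ideal R) [h : I.IsTwoSided] : Opens (PrimeSpec R) := ⟨basicSet I, I, h, rfl⟩

/-- The largest two-sided ideal `I` with `X(I) = U`: the intersection of the primes outside `U`. -/
def openIdeal (U : Opens (PrimeSpec R)) : Ideal R :=
  ⨅ P : {P : PrimeSpec R // P ∉ U}, P.1.asIdeal

instance (U : Opens (PrimeSpec R)) : (openIdeal U).IsTwoSided := by
  unfold openIdeal
  infer_instance

lemma basicOpen_openIdeal (U : Opens (PrimeSpec R)) : basicOpen (openIdeal U) = U := by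
  obtain ⟨_, I, hI, rfl⟩ := U
  refine Opens.ext (Set.ext fun P ↦ ⟨fun h h' ↦ ?_, fun h h' ↦ ?_⟩)
  · exact h (iInf_le_of_le ⟨P, fun hP ↦ hP h'⟩ le_rfl)
  · exact h (le_trans (le_iInf fun P' ↦ not_not.1 P'.2) h')

lemma openIdeal_mono {U V : Opens (PrimeSpec R)} (h : V ≤ U) : openIdeal V ≤ openIdeal U :=
  le_iInf fun P ↦ iInf_le_of_le ⟨P.1, fun hP ↦ P.2 (h hP)⟩ le_rfl

lemma kappaFilter_openIdeal {U V : Opens (PrimeSpec R)} (h : V ≤ U) :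
    kappaFilter (openIdeal U) ⊆ kappaFilter (openIdeal V) :=
  kappaFilter_mono (openIdeal_mono h)

variable (R) in
/-- The space `Spec R` with the Zariski topology. -/
abbrev SpecTop : TopCat.{u} := TopCat.of (PrimeSpec R)

variable (R) in
/-- The presheaf of rings on `Spec R` with sections `Q_I(R)` over `X(I)`. -/
def structurePresheaf : TopCat.Presheaf RingCat.{u} (SpecTop R) where
  obj U := RingCat.of (LocMod (openIdeal U.unop) R)
  map i := RingCat.ofHom (LocMod.resRing (kappaFilter_openIdeal (leOfHom i.unop)))
  map_id U := by
    ext x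
    induction x using LocMod.ind
    rfl
  map_comp i j := by
    ext x
    induction x using LocMod.ind
    rfl

variable (M : Type u) [AddCommGroup M] [Module R M]

/-- The presheaf of abelian groups on `Spec R` with sections `Q_I(M)` over `X(I)`. -/
def modulePresheafAb : (Opens (SpecTop R))ᵒᵖ ⥤ Ab.{u} where
  obj U := AddCommGrpCat.of (LocMod (openIdeal U.unop) M)
  map i := AddCommGrpCat.ofHom (LocMod.res M (kappaFilter_openIdeal (leOfHom i.unop)))
  map_id U := by
    ext x
    induction x using LocMod.ind
    rfl
  map_comp i j := by
    ext x
    induction x using LocMod.ind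
    rfl

instance (U : (Opens (SpecTop R))ᵒᵖ) :
    Module ((structurePresheaf R).obj U) ((modulePresheafAb (R := R) M).obj U) :=
  inferInstanceAs (Module (LocMod (openIdeal U.unop) R) (LocMod (openIdeal U.unop) M))

/-- The presheaf of modules on `Spec R` with sections `Q_I(M)` over `X(I)`. -/
def modulePresheaf : PresheafOfModules.{u} (structurePresheaf R) :=
  PresheafOfModules.ofPresheaf (modulePresheafAb M)
    (fun _ _ i r m ↦ LocMod.res_smul (kappaFilter_openIdeal (leOfHom i.unop)) r m)

end Spec

/-! ### Filtered sheaves and sheaves of glider representations -/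

section Filtered

variable {X : TopCat.{u}}

/-- A presheaf of rings `O` with filtrations `FO U` on its sections is a filtered sheaf of rings:
it is a sheaf of rings, all rings of sections are filtered (exhaustively and separatedly), the
restriction maps are filtered, and gluing does not raise the filtration degree. -/
structure IsFilteredRingSheaf (O : TopCat.Presheaf RingCat.{u} X)
    (FO : ∀ U : Opens X, ℤ → AddSubgroup (O.obj (op U))) : Prop where
  isSheaf : O.IsSheaf
  filtration : ∀ U, IsRingFiltration (FO U) (fun n ↦ FO U (n - 1))
  exhaustive : ∀ U, Exhaustive (FO U)
  separated : ∀ U, Separated (FO U)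
  map_mem : ∀ ⦃U V : Opens X⦄ (i : V ⟶ U) (n : ℤ), ∀ x ∈ FO U n, O.map i.op x ∈ FO V n
  glue_mem : ∀ {ι : Type u} (U : ι → Opens X) (n : ℤ) (x : O.obj (op (iSup U))),
    (∀ i, O.map (Opens.leSupr U i).op x ∈ FO (U i) n) → x ∈ FO (iSup U) n

variable {O : TopCat.Presheaf RingCat.{u} X} (FO : ∀ U : Opens X, ℤ → AddSubgroup (O.obj (op U)))
  (G : PresheafOfModules.{u} O) (FG : ∀ U : Opens X, ℤ → AddSubgroup (G.obj (op U)))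

/-- A presheaf of `O`-modules `G` with filtrations `FG U` on its sections is a presheaf of filtered
modules over the filtered presheaf of rings `O`: every `G(U)` is an exhaustively filtered
`O(U)`-module, and the restriction maps are filtered. -/
structure IsFilteredModulePresheaf : Prop where
  filtration : ∀ U, IsFiltration (FG U) (fun n ↦ FG U (n - 1))
  smul_mem : ∀ U (i j : ℤ), ∀ a ∈ FO U i, ∀ x ∈ FG U j, a • x ∈ FG U (i + j)
  exhaustive : ∀ U, Exhaustive (FG U)
  map_mem : ∀ ⦃U V : Opens X⦄ (i : V ⟶ U) (n : ℤ), ∀ x ∈ FG U n, G.map i.op x ∈ FG V n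

/-- A presheaf of filtered modules is a sheaf of filtered modules if it is a sheaf of modules and
gluing does not raise the filtration degree: if sections that glue to `x` all lie in degree `n` of
the filtration, then so does `x`. -/
structure IsFilteredModuleSheaf : Prop extends IsFilteredModulePresheaf FO G FG where
  isSheaf : TopCat.Presheaf.IsSheaf (X := X) G.presheaf
  glue_mem : ∀ {ι : Type u} (U : ι → Opens X) (n : ℤ) (x : G.obj (op (iSup U))),
    (∀ i, G.map (Opens.leSupr U i).op x ∈ FG (U i) n) → x ∈ FG (iSup U) n

/-- For a presheaf `G` of filtered modules, the subpresheaf `U ↦ L U 0 = F 0 G(U)`, with the chains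
`L U j = F (-j) G(U)`, is a sheaf of glider representations: every `L U` is a glider representation
of the positive part of the filtration of `O(U)` inside `G(U)`, and the separation and the gluing
axiom hold (the latter in all members of the chain). -/
structure IsGliderSheaf (L : ∀ U : Opens X, ℕ → AddSubgroup (G.obj (op U))) : Prop where
  presheaf : IsFilteredModulePresheaf FO G FG
  eq_degree : ∀ U (j : ℕ), L U j = FG U (-j)
  isGlider : ∀ U, IsGlider (FO U) (L U)
  separation : ∀ {ι : Type u} (U : ι → Opens X), ∀ x ∈ L (iSup U) 0,
    (∀ i, G.map (Opens.leSupr U i).op x = 0) → x = 0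
  gluing : ∀ {ι : Type u} (U : ι → Opens X) (j : ℕ) (x : ∀ i, G.obj (op (U i))),
    (∀ i, x i ∈ L (U i) j) →
    (∀ i k, G.map (Opens.infLELeft (U i) (U k)).op (x i) =
      G.map (Opens.infLERight (U i) (U k)).op (x k)) →
    ∃ y ∈ L (iSup U) j, ∀ i, G.map (Opens.leSupr U i).op y = x i

end Filtered

end

end ZarGlider

open ZarGlider

/-! Everything rests on the additivity of degrees. If $G(R)$ is a domain, or acts faithfully on
non-zero elements of $G(M)$, multiplication by an element of exact degree $i$ raises degrees by
exactly $i$ (`DegreeReflecting`). With separatedness this makes $R$ a domain. Evaluating the Rees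
ring at $X=1$ makes $R$ left Noetherian, hence left Ore.

The Ore condition compares the values of an $R$-linear map $f : L \to M$ at any two elements of $L$:
from $ax=br$ follows $a f(x)=b f(r)$. Since degrees add, a bound on the degree of $f$ at one
non-zero $r$ holds everywhere (`hasDegreeLE_of_apply`). As $0$ is a generic point of
$\mathrm{Spec}(R)$, the degree of a section is therefore visible on any single non-empty open set.
Exhaustiveness, separatedness and degree-preserving gluing all follow from this.

The sheaf property itself does not involve the filtration. Torsion-freeness makes representatives
agree wherever both are defined, so compatible sections restrict one maximal partial map
(`exists_maximal_extension`). Its domain is large enough because in a left Noetherian ring a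
two-sided ideal has a power inside any two-sided ideal with no further primes above it
(`exists_pow_le_of_forall_prime`). -/

namespace ZarGlider

/-! ### Additivity of degrees, and its consequences for $R$ -/

section DegreeReflecting

variable {R : Type*} [Ring R] (F : ℤ → AddSubgroup R) {M : Type*} [AddCommGroup M] [Module R M]
  (FM : ℤ → AddSubgroup M)

/-- Multiplication by an element of exact degree `i` shifts degrees by exactly `i`. -/
def DegreeReflecting : Prop :=
  ∀ (i n : ℤ) (r : R) (m : M), r ∈ F i → r ∉ F (i - 1) → r • m ∈ FM (i + n) → m ∈ FM n

variable {F FM}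

/-- Exhaustiveness places $m$ in some degree; from there it descends to degree $n$ one step at a
time. -/
lemma degreeReflecting_of_step (hmono : Monotone FM) (hex : Exhaustive FM)
    (h : ∀ (i j : ℤ) (r : R) (m : M), r ∈ F i → r ∉ F (i - 1) → m ∈ FM j →
      r • m ∈ FM (i + j - 1) → m ∈ FM (j - 1)) : DegreeReflecting F FM := by
  intro i n r m hr hr' hm
  have key : ∀ k : ℕ, m ∈ FM (n + k) → m ∈ FM n := by
    intro k
    induction k with
    | zero => simp
    | succ k ih =>
      intro hk
      refine ih ?_
      have := h i _ r m hr hr' hk (hmono (by push_cast; omega) hm)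
      convert this using 2
      push_cast; ring
  obtain ⟨j, hj⟩ := hex m
  -- For $j<n$ the truncation gives zero steps, and monotonicity alone suffices.
  exact key (j - n).toNat (hmono (by omega) hj)

variable (F FM) in
lemma monotone_moduleFiltration [IsRingFiltration F (fun n ↦ F (n - 1))]
    [hM : IsModuleFiltration F (fun n ↦ F (n - 1)) FM (fun n ↦ FM (n - 1))] : Monotone FM :=
  hM.toIsFiltration.mono

variable [hF : IsRingFiltration F (fun n ↦ F (n - 1))]
  [hM : IsModuleFiltration F (fun n ↦ F (n - 1)) FM (fun n ↦ FM (n - 1))]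

lemma monotone_filtration : Monotone F := hF.toIsFiltration.mono

lemma smul_mem_filtration {i j : ℤ} {r : R} {m : M} (hr : r ∈ F i) (hm : m ∈ FM j) :
    r • m ∈ FM (i + j) :=
  hM.toGradedSMul.smul_mem hr hm

lemma grMk_eq_zero_iff {A : Type*} [AddCommGroup A] {F : ℤ → AddSubgroup A} {n : ℤ} {a : F n} :
    grMk F n a = 0 ↔ (a : A) ∈ F (n - 1) :=
  QuotientAddGroup.eq_zero_iff a

/-- If $m$ did not drop in degree, its symbol would be non-zero and killed by the symbol of $r$;
faithfulness would then make the symbol of $r$ vanish, against the exactness of its degree. -/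
lemma GrFaithful.degreeReflecting (h : GrFaithful F FM) (hex : Exhaustive FM) :
    DegreeReflecting F FM := by
  refine degreeReflecting_of_step (monotone_moduleFiltration F FM) hex fun i j r m hr hr' hm hrm ↦ ?_
  by_contra hm'
  refine hr' ?_
  have := h (DirectSum.of (GrPiece FM) j (grMk FM j ⟨m, hm⟩)) (fun h0 ↦ hm' ?_)
    (DirectSum.of (GrPiece F) i (grMk F i ⟨r, hr⟩)) ?_
  · have := DirectSum.of_injective (β := GrPiece F) i (this.trans (map_zero _).symm)
    exact grMk_eq_zero_iff.1 this
  · exact grMk_eq_zero_iff.1 (DirectSum.of_injective (β := GrPiece FM) j (h0.trans (map_zero _).symm))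
  · rw [DirectSum.Gmodule.of_smul_of]
    have h0 : grMk FM (i + j) (filSMul F FM i j ⟨r, hr⟩ ⟨m, hm⟩) = 0 := grMk_eq_zero hrm
    exact (congrArg (DirectSum.of (GrPiece FM) (i + j)) h0).trans (map_zero _)

lemma degreeReflecting_self (hdomain : IsDomain (Gr F)) (hex : Exhaustive F) :
    DegreeReflecting F F := by
  refine degreeReflecting_of_step monotone_filtration hex fun i j r m hr hr' hm hrm ↦ ?_
  have h : DirectSum.of (GrPiece F) i (grMk F i ⟨r, hr⟩) *
      DirectSum.of (GrPiece F) j (grMk F j ⟨m, hm⟩) = 0 := by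
    rw [DirectSum.of_mul_of]
    have h0 : grMk F (i + j) (filSMul F F i j ⟨r, hr⟩ ⟨m, hm⟩) = 0 := grMk_eq_zero hrm
    exact (congrArg (DirectSum.of (GrPiece F) (i + j)) h0).trans (map_zero _)
  rcases mul_eq_zero.1 h with h | h
  · exact absurd (grMk_eq_zero_iff.1
      (DirectSum.of_injective (β := GrPiece F) i (h.trans (map_zero _).symm))) hr'
  · exact grMk_eq_zero_iff.1
      (DirectSum.of_injective (β := GrPiece F) j (h.trans (map_zero _).symm))

/-- Otherwise membership in one $F_n$ would propagate down to all of them, and separatedness would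
force $r=0$. -/
lemma exists_degree (hex : Exhaustive F) (hsep : Separated F) {r : R} (hr : r ≠ 0) :
    ∃ i, r ∈ F i ∧ r ∉ F (i - 1) := by
  by_contra! h
  obtain ⟨n, hn⟩ := hex r
  have key : ∀ k : ℕ, r ∈ F (n - k) := by
    intro k
    induction k with
    | zero => simpa using hn
    | succ k ih =>
      convert h _ ih using 2
      push_cast; ring
  exact hr (hsep r fun m ↦ monotone_filtration (by omega) (key (n - m).toNat))

/-- The product $ab=0$ lies in every degree, hence so does $b$. -/
lemma DegreeReflecting.noZeroDivisors (h : DegreeReflecting F F) (hex : Exhaustive F)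
    (hsep : Separated F) : NoZeroDivisors R where
  eq_zero_or_eq_zero_of_mul_eq_zero {a b} hab := by
    refine or_iff_not_imp_left.2 fun ha ↦ ?_
    obtain ⟨i, hi, hi'⟩ := exists_degree hex hsep ha
    exact hsep b fun n ↦ h i n a b hi hi' (by rw [smul_eq_mul, hab]; exact zero_mem _)

/-- Evaluation of Laurent polynomials at `X = 1`. -/
noncomputable def laurentEvalOne (R : Type*) [Ring R] : LaurentPolynomial R →+* R :=
  AddMonoidAlgebra.liftNCRingHom (RingHom.id R) 1 (fun _ _ ↦ Commute.one_right _)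

/-- Evaluation at $X=1$ maps the Rees ring onto $R$: an element $r\in F_n$ is the image of $rX^n$.
-/
lemma isNoetherianRing_of_reesRing (hex : Exhaustive F) (h : IsNoetherianRing (reesRing F)) :
    IsNoetherianRing R := by
  refine isNoetherianRing_of_surjective _ _ ((laurentEvalOne R).comp (reesRing F).subtype) ?_
  intro r
  obtain ⟨n, hn⟩ := hex r
  refine ⟨⟨AddMonoidAlgebra.single n r, fun m ↦ ?_⟩, ?_⟩
  · classical
    rw [AddMonoidAlgebra.coeff_single, Finsupp.single_apply]
    split_ifs with h
    · exact h ▸ hn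
    · exact zero_mem _
  · exact (AddMonoidAlgebra.liftNC_single _ _ _ _).trans (mul_one r)

end DegreeReflecting

/-! ### The Ore condition, and powers of ideals in Noetherian rings -/

section Ore

variable {R : Type u} [Ring R]

/-- The left Ore condition. If it failed, $(v_0,v_1)\mapsto v_0x-v_1r$ would embed $R^2$ into $R$,
which the strong rank condition for left Noetherian rings forbids. -/
lemma exists_mul_eq_mul [IsNoetherianRing R] [NoZeroDivisors R] (x : R) {r : R} (hr : r ≠ 0) :
    ∃ a b : R, a ≠ 0 ∧ a * x = b * r := by
  have : Nontrivial R := ⟨r, 0, hr⟩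
  by_contra! h
  let f : (Fin 2 → R) →ₗ[R] (Fin 1 → R) :=
    { toFun := fun v _ ↦ v 0 * x - v 1 * r
      map_add' := fun v w ↦ by ext; simp [add_mul]; abel
      map_smul' := fun c v ↦ by ext; simp [mul_sub, mul_assoc] }
  have hf : Function.Injective f := by
    rw [injective_iff_map_eq_zero]
    intro v hv
    have hv' : v 0 * x = v 1 * r := sub_eq_zero.1 (congrFun hv 0)
    have h0 : v 0 = 0 := by
      by_contra h0
      exact h _ _ h0 hv'
    rw [h0, zero_mul, eq_comm, mul_eq_zero, or_iff_left hr] at hv'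
    ext i
    fin_cases i <;> simp [h0, hv']
  exact absurd (le_of_fin_injective R f hf) (by norm_num)

/-- In a left Noetherian ring, a two-sided ideal contained in all primes over `J` has a power
contained in `J`. -/
lemma exists_pow_le_of_forall_prime [IsNoetherianRing R] (I J : Ideal R) [I.IsTwoSided]
    (hJ : J.IsTwoSided) (h : ∀ P : PrimeSpec R, J ≤ P.asIdeal → I ≤ P.asIdeal) :
    ∃ n, 0 < n ∧ I ^ n ≤ J := by
  induction J using IsNoetherian.induction with
  | hgt J ih =>
    by_cases htop : J = ⊤
    · exact ⟨1, one_pos, htop ▸ le_top⟩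
    by_cases hp : ∀ A B : Ideal R, A.IsTwoSided → B.IsTwoSided → A * B ≤ J → A ≤ J ∨ B ≤ J
    · exact ⟨1, one_pos, (Submodule.pow_one I).trans_le (h ⟨J, hJ, htop, hp⟩ le_rfl)⟩
    push Not at hp
    obtain ⟨A, B, hA, hB, hAB, hAJ, hBJ⟩ := hp
    -- As $J$ is proper and not prime, $AB\subseteq J$ with neither factor in $J$. The induction
    -- applies to the strictly larger $A+J$ and $B+J$, whose product lies in $J$.
    have step : ∀ C : Ideal R, C.IsTwoSided → ¬ C ≤ J → ∃ n, 0 < n ∧ I ^ n ≤ C ⊔ J := by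
      intro C hC hCJ
      refine ih (C ⊔ J) (lt_of_le_of_ne le_sup_right fun e ↦ hCJ (e ▸ le_sup_left)) ?_
        fun P hP ↦ h P (le_sup_right.trans hP)
      refine ⟨fun {a} b ha ↦ ?_⟩
      obtain ⟨c, hc, j, hj, rfl⟩ := Submodule.mem_sup.1 ha
      rw [add_mul]
      exact Submodule.add_mem_sup (hC.mul_mem_of_left b hc) (hJ.mul_mem_of_left b hj)
    obtain ⟨m, hm, hmA⟩ := step A hA hAJ
    obtain ⟨n, hn, hnB⟩ := step B hB hBJ
    refine ⟨m + n, by omega, ?_⟩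
    rw [Ideal.IsTwoSided.pow_add]
    refine (Ideal.mul_mono hmA hnB).trans (Ideal.mul_le.2 fun x hx y hy ↦ ?_)
    obtain ⟨a, ha, j, hj, rfl⟩ := Submodule.mem_sup.1 hx
    obtain ⟨b, hb, k, hk, rfl⟩ := Submodule.mem_sup.1 hy
    rw [add_mul, mul_add]
    exact add_mem (add_mem (hAB (Ideal.mul_mem_mul ha hb)) (J.smul_mem a hk))
      (hJ.mul_mem_of_left _ hj)

/-- The ideal attached to $X(I)$ is the intersection of the primes over $I$; it contains $I$ and has
a power inside $I$, so both define the same filter. -/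
lemma kappaFilter_openIdeal_basicOpen [IsNoetherianRing R] (I : Ideal R) [hI : I.IsTwoSided] :
    kappaFilter (openIdeal (basicOpen I)) = kappaFilter I := by
  refine (kappaFilter_mono (le_iInf fun P ↦ not_not.1 P.2)).antisymm ?_
  rintro L ⟨n, hn, hL⟩
  obtain ⟨m, hm, h⟩ := exists_pow_le_of_forall_prime (openIdeal (basicOpen I)) I hI
    fun P hP ↦ iInf_le_of_le ⟨P, fun h ↦ h hP⟩ le_rfl
  refine ⟨m * n, Nat.mul_pos hm hn, ?_⟩
  refine le_trans ?_ hL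
  clear hL hn
  induction n with
  | zero => rw [mul_zero, Submodule.pow_zero, Submodule.pow_zero]
  | succ n ih =>
    rw [Nat.mul_succ, Ideal.IsTwoSided.pow_add, Submodule.pow_succ]
    exact Ideal.mul_mono ih h

lemma exists_ne_zero_mem_kappaFilter [NoZeroDivisors R] {I : Ideal R} (hI : I ≠ ⊥) {L : Ideal R}
    (hL : L ∈ kappaFilter I) : ∃ r ∈ L, r ≠ 0 := by
  obtain ⟨n, -, h⟩ := hL
  obtain ⟨a, ha, ha0⟩ := Submodule.exists_mem_ne_zero_of_ne_bot hI
  exact ⟨a ^ n, h (Ideal.pow_mem_pow ha n), pow_ne_zero _ ha0⟩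

end Ore

/-! ### The quotient filtration on a localization -/

section QuotFil

variable {R : Type u} [Ring R] {F : ℤ → AddSubgroup R} {M : Type u} [AddCommGroup M] [Module R M]
  {FM : ℤ → AddSubgroup M} {I : Ideal R}

/-- The partial map `f` has degree at most `n`. -/
def HasDegreeLE (F : ℤ → AddSubgroup R) (FM : ℤ → AddSubgroup M) (f : R →ₗ.[R] M) (n : ℤ) : Prop :=
  ∀ (k : ℤ) (x : f.domain), (x : R) ∈ F k → f x ∈ FM (k + n)

lemma LocMod.exact {f g : DenseMap I M} (h : LocMod.mk f = LocMod.mk g) :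
    ∃ L ∈ kappaFilter I, ∀ x ∈ L, EqAt f.1 g.1 x := Quotient.exact h

lemma LocMod.eq_zero_iff {f : DenseMap I M} : LocMod.mk f = 0 ↔
    ∃ L ∈ kappaFilter I, ∀ x ∈ L, ∃ h : x ∈ f.1.domain, f.1 ⟨x, h⟩ = 0 := by
  constructor
  · intro h
    obtain ⟨L, hL, H⟩ := LocMod.exact (g := ⟨0, kappaFilter_top I⟩) h
    exact ⟨L, hL, fun x hx ↦ let ⟨a, _, e⟩ := H x hx; ⟨a, e⟩⟩
  · rintro ⟨L, hL, H⟩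
    exact LocMod.sound (g := ⟨0, kappaFilter_top I⟩)
      ⟨L, hL, fun x hx ↦ let ⟨a, e⟩ := H x hx; ⟨a, trivial, e⟩⟩

/-- The zero left ideal belongs to the filter, and every linear map vanishes on it. This disposes of
the empty open set in what follows. -/
lemma LocMod.eq_zero_of_bot (h : I = ⊥) (x : LocMod I M) : x = 0 := by
  induction x using LocMod.ind with
  | h f =>
    refine LocMod.eq_zero_iff.2 ⟨⊥, ⟨1, one_pos, ?_⟩, fun x hx ↦ ?_⟩
    · rw [Submodule.pow_one, h]
    · obtain rfl := (Submodule.mem_bot R).1 hx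
      exact ⟨zero_mem _, LinearPMap.map_zero _⟩

lemma smul_mem_quotFil [I.IsTwoSided] {i j : ℤ} {a : LocMod I R} {x : LocMod I M}
    (ha : a ∈ quotFil I F F i) (hx : x ∈ quotFil I F FM j) : a • x ∈ quotFil I F FM (i + j) := by
  obtain ⟨f, rfl, hf⟩ := ha
  obtain ⟨g, rfl, hg⟩ := hx
  refine ⟨_, (LocMod.smul_mk f g).symm, fun k y hy ↦ ?_⟩
  obtain ⟨h, h'⟩ := mem_pcomp.1 y.2
  rw [← add_assoc]
  exact hg (k + i) ⟨_, h'⟩ (hf k ⟨y, h⟩ hy)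

lemma one_mem_quotFil [I.IsTwoSided] : (1 : LocMod I R) ∈ quotFil I F F 0 :=
  ⟨_, rfl, fun k x hx ↦ by rw [add_zero]; exact hx⟩

lemma res_mem_quotFil {J : Ideal R} (h : kappaFilter I ⊆ kappaFilter J) {n : ℤ} {x : LocMod I M}
    (hx : x ∈ quotFil I F FM n) : LocMod.res M h x ∈ quotFil J F FM n := by
  obtain ⟨f, rfl, hf⟩ := hx
  exact ⟨⟨f.1, h f.2⟩, rfl, hf⟩

variable [hF : IsRingFiltration F (fun n ↦ F (n - 1))]
  [hM : IsModuleFiltration F (fun n ↦ F (n - 1)) FM (fun n ↦ FM (n - 1))]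

lemma quotFil_isFiltration : IsFiltration (quotFil I F FM) (fun n ↦ quotFil I F FM (n - 1)) := by
  refine IsFiltration.mk_int _ ?_
  rintro m n h _ ⟨f, rfl, hf⟩
  exact ⟨f, rfl, fun k x hx ↦ monotone_moduleFiltration F FM (by omega) (hf k x hx)⟩

lemma quotFil_isRingFiltration [I.IsTwoSided] :
    IsRingFiltration (quotFil I F F) (fun n ↦ quotFil I F F (n - 1)) where
  toIsFiltration := quotFil_isFiltration
  one_mem := one_mem_quotFil
  mul_mem _ _ _ _ ha hb := smul_mem_quotFil ha hb

variable [IsNoetherianRing R] [NoZeroDivisors R]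

/-- The degree of a partial map can be read off at any non-zero element of its domain. -/
lemma hasDegreeLE_of_apply (hex : Exhaustive F) (hsep : Separated F) (hR : DegreeReflecting F F)
    (hreg : DegreeReflecting F FM) {f : R →ₗ.[R] M} {i n : ℤ} {r : f.domain}
    (hr' : (r : R) ∉ F (i - 1)) (hfr : f r ∈ FM (i + n)) :
    HasDegreeLE F FM f n := by
  intro k x hx
  have hr0 : (r : R) ≠ 0 := fun h ↦ hr' (h ▸ zero_mem _)
  obtain ⟨a, b, ha, hab⟩ := exists_mul_eq_mul (x : R) hr0
  obtain ⟨s, hs, hs'⟩ := exists_degree hex hsep ha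
  have hfx : a • f x = b • f r := by
    rw [← LinearPMap.map_smul, ← LinearPMap.map_smul]
    exact congrArg f (Subtype.ext hab)
  -- Since $a$ has exact degree $s$, it is enough to bound $a f(x)=b f(r)$ by degree $s+k+n$.
  refine hreg s _ a _ hs hs' ?_
  rw [hfx]
  by_cases hb : b = 0
  · rw [hb, zero_smul]
    exact zero_mem _
  obtain ⟨t, ht, ht'⟩ := exists_degree hex hsep hb
  -- Dividing $br=ax\in F_{s+k}$ by $b$, of exact degree $t$, bounds the degree of $r$. As $r\notin
  -- F_{i-1}$, this gives $t+i\le s+k$, which is the bound needed for $b f(r)$.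
  have hrk : (r : R) ∈ F (s + k - t) := by
    refine hR t _ b r ht ht' ?_
    rw [smul_eq_mul, ← hab, add_sub_cancel]
    exact SetLike.mul_mem_graded hs hx
  have hle : i ≤ s + k - t := by
    by_contra hlt
    exact hr' (monotone_filtration (by omega) hrk)
  exact monotone_moduleFiltration F FM (by omega) (smul_mem_filtration ht hfr)

lemma exhaustive_quotFil (hex : Exhaustive F) (hsep : Separated F) (hR : DegreeReflecting F F)
    (hreg : DegreeReflecting F FM) (hexM : Exhaustive FM) : Exhaustive (quotFil I F FM) := by
  intro x
  by_cases hI : I = ⊥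
  · exact ⟨0, LocMod.eq_zero_of_bot hI x ▸ zero_mem _⟩
  induction x using LocMod.ind with
  | h f =>
    obtain ⟨r, hr, hr0⟩ := exists_ne_zero_mem_kappaFilter hI f.2
    obtain ⟨i, hi, hi'⟩ := exists_degree hex hsep hr0
    obtain ⟨j, hj⟩ := hexM (f.1 ⟨r, hr⟩)
    -- The degree of $f$ is at most that of $f(r)$ minus that of $r$, for one non-zero $r$ in its
    -- domain.
    exact ⟨j - i, f, rfl, hasDegreeLE_of_apply hex hsep hR hreg (r := ⟨r, hr⟩) hi'
      (by rwa [add_sub_cancel])⟩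

/-- The degree of a section is detected on any localization at a non-zero ideal. -/
lemma mem_quotFil_of_res (hex : Exhaustive F) (hsep : Separated F) (hR : DegreeReflecting F F)
    (hreg : DegreeReflecting F FM) {J : Ideal R} (hJ : J ≠ ⊥) (h : kappaFilter I ⊆ kappaFilter J)
    {n : ℤ} {f : DenseMap I M} (hx : LocMod.res M h (LocMod.mk f) ∈ quotFil J F FM n) :
    HasDegreeLE F FM f.1 n := by
  obtain ⟨g, hg, hgn⟩ := hx
  obtain ⟨L, hL, H⟩ := LocMod.exact (g := ⟨f.1, h f.2⟩) hg
  -- One non-zero $r$ on which $f$ agrees with the representative $g$ of degree at most $n$ controls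
  -- $f$ on its whole original domain.
  obtain ⟨r, hr, hr0⟩ := exists_ne_zero_mem_kappaFilter hJ hL
  obtain ⟨i, hi, hi'⟩ := exists_degree hex hsep hr0
  obtain ⟨a, b, e⟩ := H r hr
  exact hasDegreeLE_of_apply hex hsep hR hreg (r := ⟨r, b⟩) hi' (e ▸ hgn i ⟨r, a⟩ hi)

lemma separated_quotFil (hex : Exhaustive F) (hsep : Separated F) (hR : DegreeReflecting F F)
    (hreg : DegreeReflecting F FM) (hsepM : Separated FM) : Separated (quotFil I F FM) := by
  intro x hx
  by_cases hI : I = ⊥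
  · exact LocMod.eq_zero_of_bot hI x
  induction x using LocMod.ind with
  | h f =>
    refine LocMod.eq_zero_iff.2 ⟨_, f.2, fun y hy ↦ ⟨hy, hsepM _ fun n ↦ ?_⟩⟩
    obtain ⟨k, hk⟩ := hex y
    -- For $y\in F_k$, degree $n-k$ of the section puts the value at $y$ in degree $n$, and $n$ is
    -- arbitrary.
    have := mem_quotFil_of_res hex hsep hR hreg hI subset_rfl (hx (n - k)) k ⟨y, hy⟩ hk
    rwa [add_sub_cancel] at this

end QuotFil

/-! ### Separation and gluing for localizations -/

section Sheaf

variable {R : Type u} [Ring R] {M : Type u} [AddCommGroup M] [Module R M]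

section Extension

/-- Partial maps that agree on a large left ideal agree wherever both are defined. -/
lemma KappaTorsionFree.apply_eq {I : Ideal R} [I.IsTwoSided] (hM : KappaTorsionFree I M)
    {f g : R →ₗ.[R] M} {L : Ideal R} (hL : L ∈ kappaFilter I) (h : ∀ x ∈ L, EqAt f g x)
    {y : R} (hf : y ∈ f.domain) (hg : y ∈ g.domain) : f ⟨y, hf⟩ = g ⟨y, hg⟩ := by
  obtain ⟨n, hn, hnL⟩ := hL
  -- The power $I^n$ kills the difference of the two values: for $a\in I^n$, $ay$ is again in
  -- $I^n\subseteq L$ because $I^n$ is two-sided.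
  refine sub_eq_zero.1 (hM _ ⟨I ^ n, ⟨n, hn, le_rfl⟩, fun a ha ↦ ?_⟩)
  obtain ⟨u, v, e⟩ := h (a * y) (hnL (Ideal.IsTwoSided.mul_mem_of_left y ha))
  rw [smul_sub, sub_eq_zero, ← LinearPMap.map_smul, ← LinearPMap.map_smul]
  exact e

/-- The graph of the maximal extension of a partial map `f` defined on the two-sided ideal `A`. -/
def extensionGraph (A : Ideal R) [A.IsTwoSided] (f : R →ₗ.[R] M) (hA : A ≤ f.domain) :
    Submodule R (R × M) where
  carrier := {p | ∀ (a : R) (ha : a ∈ A),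
    f ⟨a * p.1, hA (Ideal.IsTwoSided.mul_mem_of_left _ ha)⟩ = a • p.2}
  zero_mem' a ha := by
    rw [Prod.snd_zero, smul_zero, ← LinearPMap.map_zero f]
    exact congrArg f (Subtype.ext (mul_zero a))
  add_mem' {p q} hp hq a ha := by
    rw [Prod.snd_add, smul_add, ← hp a ha, ← hq a ha, ← LinearPMap.map_add]
    exact congrArg f (Subtype.ext (mul_add a p.1 q.1))
  smul_mem' c p hp a ha := by
    rw [Prod.smul_snd, ← mul_smul, ← hp (a * c) (Ideal.IsTwoSided.mul_mem_of_left c ha)]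
    exact congrArg f (Subtype.ext (mul_assoc a c p.1).symm)

/-- A partial map defined on the two-sided ideal `A` has an extension to which every other partial
map agreeing with it on `A` restricts. -/
lemma exists_maximal_extension (A : Ideal R) [A.IsTwoSided] (f : R →ₗ.[R] M) (hA : A ≤ f.domain)
    (hM : ∀ m : M, (∀ a ∈ A, a • m = 0) → m = 0) :
    ∃ F : R →ₗ.[R] M, ∀ (g : R →ₗ.[R] M),
      (∀ (y : R) (hf : y ∈ f.domain) (hg : y ∈ g.domain), f ⟨y, hf⟩ = g ⟨y, hg⟩) →
      ∀ y ∈ g.domain, EqAt F g y := by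
  -- The relation is the graph of a map because no non-zero element of $M$ is killed by $A$.
  have hG : ∀ p ∈ extensionGraph A f hA, p.1 = 0 → p.2 = 0 := by
    intro p hp h0
    refine hM _ fun a ha ↦ ?_
    rw [← hp a ha, ← LinearPMap.map_zero f]
    exact congrArg f (Subtype.ext ((congrArg (a * ·) h0).trans (mul_zero a)))
  refine ⟨(extensionGraph A f hA).toLinearPMap, fun g hg y hy ↦ ?_⟩
  have hmem : (y, g ⟨y, hy⟩) ∈ extensionGraph A f hA := by
    intro a ha
    rw [← LinearPMap.map_smul]
    exact hg _ _ _
  have hdom : y ∈ (extensionGraph A f hA).toLinearPMap.domain := ⟨_, hmem, rfl⟩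
  refine ⟨hdom, hy, ?_⟩
  have h1 := Submodule.mem_graph_toLinearPMap hG ⟨y, hdom⟩
  exact sub_eq_zero.1 (hG _ (sub_mem h1 hmem) (sub_self y))

end Extension

lemma PrimeSpec.le_of_pow_le (P : PrimeSpec R) {I : Ideal R} [I.IsTwoSided] {n : ℕ}
    (h : I ^ n ≤ P.asIdeal) : I ≤ P.asIdeal := by
  induction n with
  | zero =>
    rw [Submodule.pow_zero, Ideal.one_eq_top, top_le_iff] at h
    exact absurd h P.ne_top
  | succ n ih =>
    rw [Ideal.IsTwoSided.pow_succ] at h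
    exact (P.le_or_le I (I ^ n) inferInstance inferInstance h).elim id ih

section GenericPoint

variable [Nontrivial R] [NoZeroDivisors R]

variable (R) in
/-- The zero ideal of a domain, as a point of the spectrum. -/
def zeroPrime : PrimeSpec R where
  asIdeal := ⊥
  isTwoSided := inferInstance
  ne_top := bot_ne_top
  le_or_le I J _ _ h := by
    simpa only [le_bot_iff, Ideal.mul_eq_bot] using h

/-- The zero ideal serves as generic point: sets containing it are the ones with a non-zero ideal,
and the intersection of two of them is again of this kind. -/
lemma openIdeal_ne_bot_iff {U : Opens (PrimeSpec R)} : openIdeal U ≠ ⊥ ↔ zeroPrime R ∈ U := by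
  constructor
  · intro h
    by_contra hU
    exact h (le_bot_iff.1 (iInf_le_of_le ⟨zeroPrime R, hU⟩ le_rfl))
  · intro h hU
    rw [← basicOpen_openIdeal U] at h
    exact h (hU.le)

end GenericPoint

variable [Nontrivial R] [NoZeroDivisors R]

/-- A single $U_i$ through the generic point suffices: a representative that vanishes on a large
left ideal there vanishes on its whole domain, by torsion-freeness. -/
lemma localization_separation
    (hM : ∀ (I : Ideal R) [I.IsTwoSided], I ≠ ⊥ → KappaTorsionFree I M) {ι : Type u}
    (U : ι → Opens (PrimeSpec R)) (x : LocMod (openIdeal (iSup U)) M)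
    (hx : ∀ i, LocMod.res M (kappaFilter_openIdeal (le_iSup U i)) x = 0) : x = 0 := by
  by_cases h : zeroPrime R ∈ iSup U
  · obtain ⟨i, hi⟩ := Opens.mem_iSup.1 h
    induction x using LocMod.ind with
    | h f =>
      obtain ⟨L, hL, H⟩ := LocMod.eq_zero_iff.1 (hx i)
      refine LocMod.eq_zero_iff.2 ⟨_, f.2, fun y hy ↦ ⟨hy, ?_⟩⟩
      exact (hM _ (openIdeal_ne_bot_iff.2 hi)).apply_eq (g := 0) hL
        (fun z hz ↦ let ⟨a, e⟩ := H z hz; ⟨a, trivial, e⟩) hy trivial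
  · exact LocMod.eq_zero_of_bot (not_not.1 (mt openIdeal_ne_bot_iff.1 h)) x

lemma localization_gluing [IsNoetherianRing R]
    (hM : ∀ (I : Ideal R) [I.IsTwoSided], I ≠ ⊥ → KappaTorsionFree I M) {ι : Type u}
    (U : ι → Opens (PrimeSpec R)) (x : ∀ i, LocMod (openIdeal (U i)) M)
    (hx : ∀ i k, LocMod.res M (kappaFilter_openIdeal (inf_le_left : U i ⊓ U k ≤ U i)) (x i) =
      LocMod.res M (kappaFilter_openIdeal (inf_le_right : U i ⊓ U k ≤ U k)) (x k)) :
    ∃ y : LocMod (openIdeal (iSup U)) M,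
      ∀ i, LocMod.res M (kappaFilter_openIdeal (le_iSup U i)) y = x i := by
  by_cases h : zeroPrime R ∈ iSup U
  swap
  · refine ⟨0, fun i ↦ ?_⟩
    have hi : zeroPrime R ∉ U i := fun hi ↦ h (Opens.mem_iSup.2 ⟨i, hi⟩)
    rw [LocMod.eq_zero_of_bot (not_not.1 (mt openIdeal_ne_bot_iff.1 hi)) (x i), map_zero]
  obtain ⟨i₀, hi₀⟩ := Opens.mem_iSup.1 h
  have hrep : ∀ i, ∃ f : DenseMap (openIdeal (U i)) M, LocMod.mk f = x i :=
    fun i ↦ Quotient.exists_rep (x i)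
  choose f hf using hrep
  obtain ⟨n₀, hn₀, hA⟩ := (f i₀).2
  -- The overlap $U_{i_0}\cap U_i$ contains the generic point, so torsion-freeness there turns
  -- agreement of classes into agreement on the whole common domain.
  have hU : ∀ i, zeroPrime R ∈ U i → ∀ (y : R) (h₀ : y ∈ (f i₀).1.domain)
      (h : y ∈ (f i).1.domain), (f i₀).1 ⟨y, h₀⟩ = (f i).1 ⟨y, h⟩ := by
    intro i hi y h₀ hy
    have e := hx i₀ i
    rw [← hf, ← hf] at e
    obtain ⟨L, hL, H⟩ := LocMod.exact (f := ⟨(f i₀).1, _⟩) (g := ⟨(f i).1, _⟩) e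
    exact (hM _ (openIdeal_ne_bot_iff.2 (show zeroPrime R ∈ U i₀ ⊓ U i from ⟨hi₀, hi⟩))).apply_eq
      hL H h₀ hy
  -- The maximal extension of the one map $f_{i_0}$ extends all the $f_i$ with $U_i$ through the
  -- generic point simultaneously.
  obtain ⟨g, hg⟩ := exists_maximal_extension (openIdeal (U i₀) ^ n₀) (f i₀).1 hA fun m hm ↦
    hM _ (openIdeal_ne_bot_iff.2 hi₀) m ⟨_, ⟨n₀, hn₀, le_rfl⟩, hm⟩
  choose n hn hnf using fun i : {i // zeroPrime R ∈ U i} ↦ (f i).2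
  have hgdom : g.domain ∈ kappaFilter (openIdeal (iSup U)) := by
    -- The domain of $g$ contains the sum of the powers on which the $f_i$ are defined. A prime
    -- containing this sum lies in no $U_i$, so a power of the ideal of the union lies in the sum.
    obtain ⟨N, hN, hle⟩ := exists_pow_le_of_forall_prime (openIdeal (iSup U))
      (⨆ i : {i // zeroPrime R ∈ U i}, openIdeal (U i) ^ n i)
      (iSup_isTwoSided _ fun i ↦ inferInstance) fun P hP ↦ by
        refine iInf_le_of_le ⟨P, fun hPU ↦ ?_⟩ le_rfl
        obtain ⟨i, hi⟩ := Opens.mem_iSup.1 hPU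
        -- A $U_i$ containing any prime contains the zero prime, so its power does occur in the sum.
        have hzero : zeroPrime R ∈ U i := by
          obtain ⟨J, -, hJ⟩ := (U i).isOpen
          have hPJ : P ∈ basicSet J := hJ ▸ hi
          have : zeroPrime R ∈ basicSet J := fun h ↦ hPJ (h.trans bot_le)
          exact (hJ ▸ this : zeroPrime R ∈ (U i : Set (PrimeSpec R)))
        rw [← basicOpen_openIdeal (U i)] at hi
        refine hi (PrimeSpec.le_of_pow_le P (n := n ⟨i, hzero⟩) ?_)
        exact (le_iSup (fun i : {i // zeroPrime R ∈ U i} ↦ openIdeal (U i) ^ n i)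
          ⟨i, hzero⟩).trans hP
    refine ⟨N, hN, hle.trans (iSup_le fun i y hy ↦ ?_)⟩
    obtain ⟨a, -⟩ := hg (f i).1 (hU i i.2) y (hnf i hy)
    exact a
  refine ⟨LocMod.mk ⟨g, hgdom⟩, fun i ↦ ?_⟩
  by_cases hi : zeroPrime R ∈ U i
  · rw [← hf i]
    exact LocMod.sound ⟨_, (f i).2, fun y hy ↦ hg (f i).1 (hU i hi) y hy⟩
  · have hbot := not_not.1 (mt openIdeal_ne_bot_iff.1 hi)
    rw [LocMod.eq_zero_of_bot hbot (x i), LocMod.eq_zero_of_bot hbot (LocMod.res M _ _)]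

lemma localization_existsUnique_gluing [IsNoetherianRing R]
    (hM : ∀ (I : Ideal R) [I.IsTwoSided], I ≠ ⊥ → KappaTorsionFree I M) {ι : Type u}
    (U : ι → Opens (PrimeSpec R)) (x : ∀ i, LocMod (openIdeal (U i)) M)
    (hx : ∀ i k, LocMod.res M (kappaFilter_openIdeal (inf_le_left : U i ⊓ U k ≤ U i)) (x i) =
      LocMod.res M (kappaFilter_openIdeal (inf_le_right : U i ⊓ U k ≤ U k)) (x k)) :
    ∃! y : LocMod (openIdeal (iSup U)) M,
      ∀ i, LocMod.res M (kappaFilter_openIdeal (le_iSup U i)) y = x i := by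
  obtain ⟨y, hy⟩ := localization_gluing hM U x hx
  refine ⟨y, hy, fun z hz ↦ sub_eq_zero.1 (localization_separation hM U (z - y) fun i ↦ ?_)⟩
  rw [map_sub, sub_eq_zero]
  exact (hz i).trans (hy i).symm

lemma mem_quotFil_of_locally [IsNoetherianRing R] {F : ℤ → AddSubgroup R}
    {FM : ℤ → AddSubgroup M} [IsRingFiltration F (fun n ↦ F (n - 1))]
    [IsModuleFiltration F (fun n ↦ F (n - 1)) FM (fun n ↦ FM (n - 1))] (hex : Exhaustive F)
    (hsep : Separated F) (hR : DegreeReflecting F F) (hreg : DegreeReflecting F FM) {ι : Type u}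
    (U : ι → Opens (PrimeSpec R)) (n : ℤ) (x : LocMod (openIdeal (iSup U)) M)
    (hx : ∀ i, LocMod.res M (kappaFilter_openIdeal (le_iSup U i)) x ∈
      quotFil (openIdeal (U i)) F FM n) : x ∈ quotFil (openIdeal (iSup U)) F FM n := by
  by_cases h : zeroPrime R ∈ iSup U
  · obtain ⟨i, hi⟩ := Opens.mem_iSup.1 h
    induction x using LocMod.ind with
    | h f =>
      exact ⟨f, rfl, mem_quotFil_of_res hex hsep hR hreg (openIdeal_ne_bot_iff.2 hi) _ (hx i)⟩
  · rw [LocMod.eq_zero_of_bot (not_not.1 (mt openIdeal_ne_bot_iff.1 h)) x]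
    exact zero_mem _

lemma structurePresheaf_isSheaf [IsNoetherianRing R] : (structurePresheaf R).IsSheaf := by
  -- Over a domain torsion-freeness is automatic, since every member of the filter contains a
  -- non-zero element.
  have hR : ∀ (I : Ideal R) [I.IsTwoSided], I ≠ ⊥ → KappaTorsionFree I R := by
    rintro I _ hI m ⟨L, hL, h⟩
    obtain ⟨r, hr, hr0⟩ := exists_ne_zero_mem_kappaFilter hI hL
    exact (mul_eq_zero.1 (h r hr)).resolve_left hr0
  rw [TopCat.Presheaf.isSheaf_iff_isSheafUniqueGluing]
  exact fun ι U x hx ↦ localization_existsUnique_gluing hR U x hx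

lemma modulePresheaf_isSheaf [IsNoetherianRing R]
    (hM : ∀ (I : Ideal R) [I.IsTwoSided], I ≠ ⊥ → KappaTorsionFree I M) :
    TopCat.Presheaf.IsSheaf (X := SpecTop R) (modulePresheaf (R := R) M).presheaf := by
  rw [TopCat.Presheaf.isSheaf_iff_isSheafUniqueGluing]
  exact fun ι U x hx ↦ localization_existsUnique_gluing hM U x hx

end Sheaf

/-! ### Filtered sheaves and glider sheaves -/

lemma isGlider_neg_degrees {R : Type*} [Ring R] {F : ℤ → AddSubgroup R} {M : Type*}
    [AddCommGroup M] [Module R M] {FM : ℤ → AddSubgroup M} (hmono : Monotone FM)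
    (hsmul : ∀ i j : ℤ, ∀ a ∈ F i, ∀ m ∈ FM j, a • m ∈ FM (i + j)) :
    IsGlider F (fun j : ℕ ↦ FM (-j)) where
  anti m n h := hmono (by omega)
  smul_mem i j h a ha m hm := by
    have := hsmul i (-j) a ha m hm
    -- The subtraction of natural numbers is not truncated, because $i\le j$.
    rwa [show (i : ℤ) + -j = -((j - i : ℕ) : ℤ) by omega] at this

section

variable {R : Type u} [Ring R] [Nontrivial R] [NoZeroDivisors R] [IsNoetherianRing R]
  {F : ℤ → AddSubgroup R} [hF : IsRingFiltration F (fun n ↦ F (n - 1))]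

lemma structurePresheaf_isFilteredRingSheaf (hex : Exhaustive F) (hsep : Separated F)
    (hR : DegreeReflecting F F) :
    IsFilteredRingSheaf (structurePresheaf R) (fun U ↦ quotFil (openIdeal U) F F) where
  isSheaf := structurePresheaf_isSheaf
  filtration _ := quotFil_isRingFiltration
  exhaustive _ := exhaustive_quotFil hex hsep hR hR hex
  separated _ := separated_quotFil hex hsep hR hR hsep
  map_mem _ _ i _ _ hx := res_mem_quotFil (kappaFilter_openIdeal (leOfHom i)) hx
  glue_mem U n x hx := mem_quotFil_of_locally hex hsep hR hR U n x hx

variable {M : Type u} [AddCommGroup M] [Module R M] {FM : ℤ → AddSubgroup M}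
  [hM : IsModuleFiltration F (fun n ↦ F (n - 1)) FM (fun n ↦ FM (n - 1))]

lemma modulePresheaf_isFilteredModuleSheaf (hex : Exhaustive F) (hsep : Separated F)
    (hR : DegreeReflecting F F) (hreg : DegreeReflecting F FM) (hexM : Exhaustive FM)
    (htf : ∀ (I : Ideal R) [I.IsTwoSided], I ≠ ⊥ → KappaTorsionFree I M) :
    IsFilteredModuleSheaf (O := structurePresheaf R) (fun U ↦ quotFil (openIdeal U) F F)
      (modulePresheaf M) (fun U ↦ quotFil (openIdeal U) F FM) where
  filtration _ := quotFil_isFiltration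
  smul_mem _ _ _ _ ha _ hx := smul_mem_quotFil ha hx
  exhaustive _ := exhaustive_quotFil hex hsep hR hreg hexM
  map_mem _ _ i _ _ hx := res_mem_quotFil (kappaFilter_openIdeal (leOfHom i)) hx
  isSheaf := modulePresheaf_isSheaf htf
  glue_mem U n x hx := mem_quotFil_of_locally hex hsep hR hreg U n x hx

lemma modulePresheaf_isGliderSheaf (hex : Exhaustive F) (hsep : Separated F)
    (hR : DegreeReflecting F F) (hreg : DegreeReflecting F FM) (hexM : Exhaustive FM)
    (htf : ∀ (I : Ideal R) [I.IsTwoSided], I ≠ ⊥ → KappaTorsionFree I M) :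
    IsGliderSheaf (O := structurePresheaf R) (fun U ↦ quotFil (openIdeal U) F F)
      (modulePresheaf M) (fun U ↦ quotFil (openIdeal U) F FM)
      (fun U j ↦ quotFil (openIdeal U) F FM (-j)) where
  presheaf :=
    (modulePresheaf_isFilteredModuleSheaf hex hsep hR hreg hexM htf).toIsFilteredModulePresheaf
  eq_degree U j := rfl
  isGlider U := isGlider_neg_degrees (R := LocMod (openIdeal U) R) (M := LocMod (openIdeal U) M)
    (quotFil_isFiltration (F := F)).mono fun _ _ _ ha _ hx ↦ smul_mem_quotFil ha hx
  separation U x _ hx := localization_separation htf U x hx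
  gluing U j x hxj hx := by
    obtain ⟨y, hy⟩ := localization_gluing htf U x hx
    -- The gluing is found without regard to degrees; that it lies in degree $-j$ is then read off
    -- from its restrictions.
    exact ⟨y, mem_quotFil_of_locally hex hsep hR hreg U (-j) y fun i ↦ by
      rw [hy i]; exact hxj i, hy⟩

end

end ZarGlider

theorem mainTheorem5 {R : Type u} [Ring R] (F : ℤ → AddSubgroup R)
    [IsRingFiltration F (fun n ↦ F (n - 1))]
    (hZariskian : IsZariskian F) (hprime : IsPrimeRing R)
    (hcomm : ∀ x y : Gr F, x * y = y * x) (hdomain : IsDomain (Gr F)) :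
    (∀ (I : Ideal R) [I.IsTwoSided], kappaFilter (openIdeal (basicOpen I)) = kappaFilter I) ∧
    IsFilteredRingSheaf (structurePresheaf R) (fun U ↦ quotFil (openIdeal U) F F) ∧
    (∀ (M : Type u) [AddCommGroup M] [Module R M] (FM : ℤ → AddSubgroup M)
        [IsModuleFiltration F (fun n ↦ F (n - 1)) FM (fun n ↦ FM (n - 1))],
      Exhaustive FM →
      (∀ (I : Ideal R) [I.IsTwoSided], I ≠ ⊥ → KappaTorsionFree I M) →
      GrFaithful F FM →
      IsFilteredModuleSheaf (O := structurePresheaf R) (fun U ↦ quotFil (openIdeal U) F F)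
        (modulePresheaf M) (fun U ↦ quotFil (openIdeal U) F FM)) ∧
    (∀ (Ω : Type u) [AddCommGroup Ω] [Module R Ω] (FΩ : ℤ → AddSubgroup Ω)
        [IsModuleFiltration F (fun n ↦ F (n - 1)) FΩ (fun n ↦ FΩ (n - 1))]
        (L : ℕ → AddSubgroup Ω),
      IsGlider F L →
      (∀ j : ℕ, FΩ (-j) = L j) →
      Exhaustive FΩ →
      (∀ (I : Ideal R) [I.IsTwoSided], I ≠ ⊥ → KappaTorsionFree I Ω) →
      GrFaithful F FΩ →
      IsGliderSheaf (O := structurePresheaf R) (fun U ↦ quotFil (openIdeal U) F F)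
        (modulePresheaf Ω) (fun U ↦ quotFil (openIdeal U) F FΩ)
        (fun U j ↦ quotFil (openIdeal U) F FΩ (-j))) := by
  have hex := hZariskian.exhaustive
  have hsep := hZariskian.separated
  have hR := degreeReflecting_self hdomain hex
  have : Nontrivial R := hprime.1
  have : NoZeroDivisors R := hR.noZeroDivisors hex hsep
  have : IsNoetherianRing R := isNoetherianRing_of_reesRing hex hZariskian.noetherian
  exact ⟨fun I _ ↦ kappaFilter_openIdeal_basicOpen I,
    structurePresheaf_isFilteredRingSheaf hex hsep hR,
    fun M _ _ FM _ hexM htf hfaith ↦ modulePresheaf_isFilteredModuleSheaf hex hsep hR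
      (hfaith.degreeReflecting hexM) hexM htf,
    fun Ω _ _ FΩ _ L _ _ hexΩ htf hfaith ↦ modulePresheaf_isGliderSheaf hex hsep hR
      (hfaith.degreeReflecting hexΩ) hexΩ htf⟩
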